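/- All graphs are finite and simple. A \emph{plane graph} is a graph together with a crossing-free drawing in the plane: vertices are distinct points, each edge is a polygonal arc joining its two ends and containing no other vertex, and two distinct edges meet at most in common ends; its \emph{faces} are the connected components of the complement of the drawing, and the \emph{outer face} is the unbounded one. A plane graph $H$ is a \emph{near-triangulation} if every face of $H$ except for the outer one has length three, that is, is bounded by a triangle of $H$. Let $n\ge 0$ be an integer. A triple $(G,S_1,S_2)$, where $G$ is a graph and $S_1$, $S_2$ are vertex-disjoint (non-empty) connected subgraphs of $G$, is an \emph{$(n\times n)$-slab} with sides $S_1,S_2$ if there exist pairwise vertex-disjoint near-triangulations $R_1,\dots,R_n\subseteq G$ (the \emph{rows}) and pairwise vertex-disjoint near-triangulations $C_1,\dots,C_n\subseteq G$ (the \emph{columns}) such that for all $1\le i,j\le n$ the intersection $R_i\cap C_j$ is a path with one end in $S_1$ and the other end in $S_2$, and such that for every $s\in\{1,2\}$ and every row or column $H$, the intersection $H\cap S_s$ is a subpath of the boundary of the outer face of $H$. \textbf{Theorem 3.} Let $(G,S_1,S_2)$ be an $(n\times n)$-slab with rows and columns of maximum degree at most $\Delta$, where $\Delta\ge 3$ is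 an integer, and let $X\subseteq V(G)\setminus(V(S_1)\cup V(S_2))$. If every path in $G$ from $S_1$ to $S_2$ intersects $X$, then the induced subgraph $G[X]$ has tree-width at least $\dfrac{n}{\sqrt{3\Delta}}-1$. -/

import Mathlib

namespace Slab

/-! ### Tree-width -/

/-- A tree decomposition of `G` with tree nodes `ι`: a tree on `ι` and a bag for each node, such
that every vertex and every edge of `G` lies in some bag, and for each vertex the nodes whose bags
contain it induce a connected subtree. -/
structure TreeDecomposition {W : Type*} (G : SimpleGraph W) (ι : Type*) where
  /-- the tree -/
  tree : SimpleGraph ι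
  isTree : tree.IsTree
  /-- the bags -/
  bag : ι → Set W
  exists_mem_bag : ∀ v, ∃ i, v ∈ bag i
  exists_adj_bag : ∀ ⦃u v⦄, G.Adj u v → ∃ i, u ∈ bag i ∧ v ∈ bag i
  connected : ∀ v, (tree.induce {i | v ∈ bag i}).Connected

/-- `G` has a tree decomposition (over a finite tree) all of whose bags have at most `w + 1`
vertices, that is, a tree decomposition of width at most `w`. -/
def TreewidthAtMost {W : Type*} (G : SimpleGraph W) (w : ℕ) : Prop :=
  ∃ (ι : Type) (_ : Finite ι) (D : TreeDecomposition G ι), ∀ i, (D.bag i).encard ≤ w + 1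

/-- The tree-width of a finite graph: the least width of a tree decomposition. -/
noncomputable def treewidth {W : Type*} (G : SimpleGraph W) : ℕ :=
  sInf {w | TreewidthAtMost G w}

/-- The infimum in the definition of tree-width is over a nonempty set for a finite graph. -/
theorem exists_treewidthAtMost {W : Type*} [Finite W] (G : SimpleGraph W) :
    ∃ w, TreewidthAtMost G w := by
  refine ⟨Nat.card W, Unit, inferInstance,
    { tree := ⊥
      isTree := SimpleGraph.IsTree.of_subsingleton
      bag := fun _ => Set.univ
      exists_mem_bag := fun v => ⟨(), trivial⟩
      exists_adj_bag := fun u v _ => ⟨(), trivial, trivial⟩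
      connected := fun v => ?_ }, fun i => ?_⟩
  · have : Nonempty {i : Unit | v ∈ (Set.univ : Set W)} := ⟨⟨(), trivial⟩⟩
    exact (SimpleGraph.IsTree.of_subsingleton).1
  · simp only [Set.encard_univ]
    rw [ENat.card_eq_coe_natCard]
    exact le_self_add

/-! ### Plane graphs; the plane is `ℂ` -/

/-- `A` is a polygonal arc in the plane with ends `x` and `y`: a union of consecutive nondegenerate
straight line segments `[p i, p (i + 1)]`, where two consecutive segments share only their common
end and any other two are disjoint. -/
def IsPolygonalArc (A : Set ℂ) (x y : ℂ) : Prop :=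
  ∃ (m : ℕ) (p : ℕ → ℂ), 0 < m ∧ p 0 = x ∧ p m = y ∧
    A = ⋃ i ∈ Set.Iio m, segment ℝ (p i) (p (i + 1)) ∧
    (∀ i < m, p i ≠ p (i + 1)) ∧
    ∀ i j, i < j → j < m →
      segment ℝ (p i) (p (i + 1)) ∩ segment ℝ (p j) (p (j + 1)) ⊆ {z | j = i + 1 ∧ z = p j}

variable {V : Type*} {G : SimpleGraph V}

/-- A drawing of the graph `H` (given as a subgraph of `G`) in the plane without crossings:
vertices are distinct points, every edge is a polygonal arc joining its ends, an edge contains no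
vertices but its ends, and two different edges meet only in common ends. A graph with such a
drawing is a plane graph. -/
structure PlaneDrawing (H : G.Subgraph) where
  /-- the position of a vertex (irrelevant outside `H`) -/
  pos : V → ℂ
  /-- the arc representing an edge (irrelevant outside `H`) -/
  arc : Sym2 V → Set ℂ
  pos_injOn : Set.InjOn pos H.verts
  isArc : ∀ ⦃u v⦄, H.Adj u v → IsPolygonalArc (arc s(u, v)) (pos u) (pos v)
  mem_of_pos_mem : ∀ e ∈ H.edgeSet, ∀ w ∈ H.verts, pos w ∈ arc e → w ∈ e
  arc_inter : ∀ e ∈ H.edgeSet, ∀ e' ∈ H.edgeSet, e ≠ e' →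
    arc e ∩ arc e' ⊆ pos '' {w | w ∈ e ∧ w ∈ e'}

namespace PlaneDrawing

variable {H : G.Subgraph} (D : PlaneDrawing H)

/-- The set of points of the plane covered by the drawing. -/
def support : Set ℂ := D.pos '' H.verts ∪ ⋃ e ∈ H.edgeSet, D.arc e

/-- A face is a connected component of the complement of the drawing. -/
def IsFace (F : Set ℂ) : Prop :=
  ∃ z ∈ D.supportᶜ, F = connectedComponentIn D.supportᶜ z

/-- The outer face: all points that lie in an unbounded component of the complement of the drawing.
(The drawing of a finite graph is compact, so that there is exactly one such component.) -/
def outerFace : Set ℂ :=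
  {z ∈ D.supportᶜ | ¬ Bornology.IsBounded (connectedComponentIn D.supportᶜ z)}

/-- Near-triangulation: every face other than the outer one has length three, that is, its boundary
is (the drawing of) a triangle of `H`. -/
def IsNearTriangulation : Prop :=
  ∀ F, D.IsFace F → Bornology.IsBounded F →
    ∃ a b c, H.Adj a b ∧ H.Adj b c ∧ H.Adj c a ∧
      frontier F = D.arc s(a, b) ∪ D.arc s(b, c) ∪ D.arc s(c, a)

/-- The boundary of the outer face, as a subgraph: it consists of the vertices and edges of `H`
that are drawn inside the topological boundary of the outer face. -/
def outerBoundary : G.Subgraph where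
  verts := {v ∈ H.verts | D.pos v ∈ frontier D.outerFace}
  Adj u v := H.Adj u v ∧ D.arc s(u, v) ⊆ frontier D.outerFace ∧
    D.pos u ∈ frontier D.outerFace ∧ D.pos v ∈ frontier D.outerFace
  adj_sub h := h.1.adj_sub
  edge_vert h := ⟨h.1.fst_mem, h.2.2.1⟩
  symm := ⟨fun _ _ h => ⟨h.1.symm, Sym2.eq_swap ▸ h.2.1, h.2.2.2, h.2.2.1⟩⟩

end PlaneDrawing

/-! ### Slabs -/

/-- The subgraph `P` of `G` is a path with ends `u` and `v` (a single vertex if `u = v`). -/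
def IsPathBetween (P : G.Subgraph) (u v : V) : Prop :=
  ∃ p : G.Walk u v, p.IsPath ∧ p.toSubgraph = P

/-- `H` can be drawn as a near-triangulation so that its intersection with each of `S₁` and `S₂` is
a subpath of the boundary of the outer face. -/
def IsSlabLayer (S₁ S₂ H : G.Subgraph) : Prop :=
  ∃ D : PlaneDrawing H, D.IsNearTriangulation ∧
    ∀ S : G.Subgraph, S = S₁ ∨ S = S₂ →
      (∃ u v, IsPathBetween (H ⊓ S) u v) ∧ H ⊓ S ≤ D.outerBoundary

/-- `(G, S₁, S₂)` is an `(n × n)`-slab with rows `R` and columns `C`. -/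
structure IsSlab (G : SimpleGraph V) (S₁ S₂ : G.Subgraph) (n : ℕ) (R C : Fin n → G.Subgraph) :
    Prop where
  connected_left : S₁.Connected
  connected_right : S₂.Connected
  disjoint_sides : Disjoint S₁.verts S₂.verts
  disjoint_rows : ∀ i j, i ≠ j → Disjoint (R i).verts (R j).verts
  disjoint_cols : ∀ i j, i ≠ j → Disjoint (C i).verts (C j).verts
  row_layer : ∀ i, IsSlabLayer S₁ S₂ (R i)
  col_layer : ∀ j, IsSlabLayer S₁ S₂ (C j)
  inter_path : ∀ i j, ∃ u ∈ S₁.verts, ∃ v ∈ S₂.verts, IsPathBetween (R i ⊓ C j) u v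

/-- The graph `H` has maximum degree at most `d`. -/
def MaxDegreeAtMost (H : G.Subgraph) (d : ℕ) : Prop :=
  ∀ v ∈ H.verts, (H.neighborSet v).encard ≤ d

end Slab

/-! A separator of an `(n × n)`-slab induces a subgraph of tree-width at least `n - 1`
(`Slab.IsSlab.le_of_treewidthAtMost`), which is at least the required bound.

Let `T` be the set of vertices that can be reached from the first side without meeting the
separator `X`. For a set `Z` and a union `K` of components of the graph induced by `X \ Z`, the
number of edges from `T` to `K`, modulo 2, defines an edge function that sums to zero over each
triangle that avoids `Z` (`Slab.crossing_triangle`): if just one vertex of the triangle lies in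
`T`, then the other two lie in `X \ Z` and are adjacent, so both or none of them lie in `K`. As
the triangles of a near-triangulation generate its cycle space modulo 2, and as no edge of a side
joins `T` to `K`, the parity of the number of such edges is the same for all paths between the
sides inside a row or column that avoids `Z` (`Slab.IsSlabLayer.walkParity_eq`). Going along a row
and then along a column, this gives a parity for `K` that is common to all paths `R i ⊓ C j` with
`R i` and `C j` avoiding `Z`. It is additive in `K`, and odd for `K = X \ Z`, because the paths
lead from inside `T` to outside of it.

Given a tree decomposition whose bags have fewer than `n` vertices, each bag avoids some row and
some column. At each node of the tree, the part of `X` outside of the bag has odd parity, so the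
part behind one of the neighbours has odd parity; point to this neighbour. In a finite tree two
adjacent nodes point to each other. But then the two parts on either side of an edge of the tree
are both odd, although together they form the complement in `X` of the intersection of the two
bags, and so their sum is odd: a contradiction (`Slab.exists_bag_forall_not_good`).

It remains to see that the facial triangles generate the cycle space of a near-triangulation
(`Slab.PlaneDrawing.IsNearTriangulation.sum_edges_eq_zero`). This does not need the Jordan curve
theorem. For an arc from `x` to `y` the function `(x - z) * (y - z)` has a continuous square root on
the complement of the arc, which changes its sign across the arc (`Slab.ArcRoot`). Multiplying these
roots along a closed walk and dividing by `pos v - z` for the vertices `v` of the walk gives a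
function with values `1` and `-1` that is constant on faces, is `1` on unbounded faces, and changes
its sign across precisely the edges that the walk traverses an odd number of times. Hence the walk
is the sum of the boundaries of the bounded faces on which the function is `-1`. -/

namespace Slab

open Filter Topology

/-! ### A square root branched along a polygonal arc -/

/-- The principal square root of `(b - z) / (a - z)`, as a function of `z`. Its branch cut is the
segment from `a` to `b`. -/
noncomputable def ratioSqrt (a b z : ℂ) : ℂ := ((b - z) / (a - z)) ^ (((2 : ℕ) : ℂ)⁻¹)

theorem ratioSqrt_sq (a b z : ℂ) : ratioSqrt a b z ^ 2 = (b - z) / (a - z) :=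
  Complex.cpow_nat_inv_pow _ two_ne_zero

theorem continuousAt_ratioSqrt {a b z : ℂ} (hz : z ∉ segment ℝ a b) :
    ContinuousAt (ratioSqrt a b) z := by
  have hza : a - z ≠ 0 := fun h => hz (by rw [← sub_eq_zero.1 h]; exact left_mem_segment ℝ a b)
  refine ContinuousAt.comp (g := fun w : ℂ => w ^ (((2 : ℕ) : ℂ)⁻¹))
    (continuousAt_cpow_const ?_) (by fun_prop (disch := exact hza))
  rw [Complex.mem_slitPlane_iff]
  by_contra! h
  obtain ⟨hre, him⟩ := h
  -- a nonpositive ratio `-t` exhibits `z` as the convex combination `(t a + b) / (1 + t)`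
  set t : ℝ := -((b - z) / (a - z)).re with ht
  have ht0 : 0 ≤ t := by linarith
  have hw : (b - z) / (a - z) = -(t : ℂ) := by
    apply Complex.ext <;> simp [ht, him]
  rw [div_eq_iff hza] at hw
  apply hz
  have h1 : (1 + t) ≠ 0 := by positivity
  have h1' : (1 + t : ℂ) ≠ 0 := by exact_mod_cast h1
  refine ⟨t / (1 + t), 1 / (1 + t), by positivity, by positivity, by field_simp; ring, ?_⟩
  simp only [Complex.real_smul]
  push_cast
  field_simp
  linear_combination hw

theorem tendsto_ratioSqrt_cobounded (a b : ℂ) :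
    Tendsto (ratioSqrt a b) (Bornology.cobounded ℂ) (𝓝 1) := by
  have h1 : Tendsto (fun z => 1 + (b - a) * (a - z)⁻¹) (Bornology.cobounded ℂ) (𝓝 1) := by
    have := (tendsto_inv₀_cobounded.comp (tendsto_const_sub_cobounded a)).const_mul (b - a)
    simpa using this.const_add 1
  have h2 : Tendsto (fun z => (b - z) / (a - z)) (Bornology.cobounded ℂ) (𝓝 1) := by
    refine h1.congr' ?_
    have : ∀ᶠ z in Bornology.cobounded ℂ, z ≠ a :=
      Bornology.isBounded_def.1 (Bornology.isBounded_singleton (x := a))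
    filter_upwards [this] with z hz
    have : a - z ≠ 0 := sub_ne_zero.2 hz.symm
    field_simp
    ring
  have h3 : ContinuousAt (fun w : ℂ => w ^ (((2 : ℕ) : ℂ)⁻¹)) 1 :=
    continuousAt_cpow_const (by simp [Complex.mem_slitPlane_iff])
  have := h3.tendsto.comp h2
  rwa [Complex.one_cpow] at this

theorem cpow_half_of_im_pos {w : ℂ} (hw : 0 < w.im) :
    w ^ (((2 : ℕ) : ℂ)⁻¹) = (-w) ^ (((2 : ℕ) : ℂ)⁻¹) * Complex.I := by
  have h0 : w ≠ 0 := by rintro rfl; simp at hw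
  rw [Complex.cpow_def_of_ne_zero h0, Complex.cpow_def_of_ne_zero (neg_ne_zero.2 h0),
    ← Complex.exp_pi_div_two_mul_I, ← Complex.exp_add, Complex.log, Complex.log, norm_neg,
    Complex.arg_neg_eq_arg_sub_pi_of_im_pos hw]
  congr 1
  push_cast
  ring

theorem cpow_half_of_im_neg {w : ℂ} (hw : w.im < 0) :
    w ^ (((2 : ℕ) : ℂ)⁻¹) = -((-w) ^ (((2 : ℕ) : ℂ)⁻¹) * Complex.I) := by
  have h := cpow_half_of_im_pos (w := -w) (by simpa using hw)
  rw [neg_neg] at h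
  rw [h, mul_assoc, Complex.I_mul_I]
  ring

theorem im_ratio_midpoint {a b z : ℂ} (hab : a ≠ b) (hz : a - z ≠ 0) :
    ((b - z) / (a - z)).im =
      4 * ((z - (a + b) / 2) / (b - a)).im /
        Complex.normSq (1 + 2 * ((z - (a + b) / 2) / (b - a))) := by
  have hba : b - a ≠ 0 := sub_ne_zero.2 hab.symm
  set ζ := (z - (a + b) / 2) / (b - a) with hζ
  have hz' : z = (a + b) / 2 + ζ * (b - a) := by rw [hζ]; field_simp; ring
  have h1 : (1 + 2 * ζ) ≠ 0 := by
    intro h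
    apply hz
    rw [hz']
    linear_combination -(b - a) / 2 * h
  have : (b - z) / (a - z) = 1 - 2 * (1 + 2 * ζ)⁻¹ := by
    rw [div_eq_iff hz]
    field_simp
    rw [hz']
    ring
  rw [this]
  simp [Complex.inv_im]
  ring

/-- The square root changes its sign from `I` to `-I` across the midpoint of its branch cut. -/
theorem tendsto_ratioSqrt_midpoint {a b : ℂ} (hab : a ≠ b) :
    Tendsto (ratioSqrt a b) (𝓝[{z | 0 < ((z - (a + b) / 2) / (b - a)).im}] ((a + b) / 2))
        (𝓝 Complex.I) ∧
      Tendsto (ratioSqrt a b) (𝓝[{z | ((z - (a + b) / 2) / (b - a)).im < 0}] ((a + b) / 2))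
        (𝓝 (-Complex.I)) := by
  have hba : b - a ≠ 0 := sub_ne_zero.2 hab.symm
  have haq : a - (a + b) / 2 ≠ 0 := by
    intro h
    apply hba
    linear_combination -2 * h
  have hq : -((b - (a + b) / 2) / (a - (a + b) / 2)) = 1 := by
    rw [← neg_div, div_eq_iff haq]
    ring
  have hcont : ContinuousAt (fun z => (-((b - z) / (a - z))) ^ (((2 : ℕ) : ℂ)⁻¹) * Complex.I)
      ((a + b) / 2) := by
    refine ContinuousAt.mul ?_ continuousAt_const
    refine ContinuousAt.comp (g := fun w : ℂ => w ^ (((2 : ℕ) : ℂ)⁻¹))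
      (continuousAt_cpow_const ?_) (by fun_prop (disch := exact haq))
    rw [hq]
    simp [Complex.mem_slitPlane_iff]
  have hlim := hcont.tendsto
  rw [hq, Complex.one_cpow, one_mul] at hlim
  have hne : ∀ᶠ z in 𝓝 ((a + b) / 2), a - z ≠ 0 :=
    (show ContinuousAt (fun z => a - z) ((a + b) / 2) by fun_prop).eventually_ne haq
  have hpos : ∀ z, ((z - (a + b) / 2) / (b - a)).im ≠ 0 →
      0 < Complex.normSq (1 + 2 * ((z - (a + b) / 2) / (b - a))) := by
    intro z hz
    rw [Complex.normSq_pos]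
    intro h
    apply hz
    have := congrArg Complex.im h
    simpa using this
  constructor
  · refine (hlim.mono_left nhdsWithin_le_nhds).congr' ?_
    filter_upwards [self_mem_nhdsWithin, nhdsWithin_le_nhds hne] with z hz hz'
    rw [ratioSqrt, cpow_half_of_im_pos (w := (b - z) / (a - z))]
    rw [im_ratio_midpoint hab hz']
    exact div_pos (mul_pos (by norm_num) hz) (hpos z (ne_of_gt hz))
  · refine (hlim.neg.mono_left nhdsWithin_le_nhds).congr' ?_
    filter_upwards [self_mem_nhdsWithin, nhdsWithin_le_nhds hne] with z hz hz'
    rw [ratioSqrt, cpow_half_of_im_neg (w := (b - z) / (a - z))]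
    rw [im_ratio_midpoint hab hz']
    exact div_neg_of_neg_of_pos (mul_neg_of_pos_of_neg (by norm_num) hz) (hpos z (ne_of_lt hz))

theorem isCompact_segment (a b : ℂ) : IsCompact (segment ℝ a b) := by
  rw [segment_eq_image_lineMap]
  exact isCompact_Icc.image (AffineMap.lineMap_continuous)

theorem im_eq_zero_of_mem_segment {a b z : ℂ} (hz : z ∈ segment ℝ a b) :
    ((z - (a + b) / 2) / (b - a)).im = 0 := by
  obtain ⟨α, β, -, -, hαβ, rfl⟩ := hz
  by_cases hba : b - a = 0
  · simp [hba]
  have hα : (α : ℂ) = 1 - β := by exact_mod_cast eq_sub_of_add_eq hαβ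
  have : (α • a + β • b - (a + b) / 2) / (b - a) = ((β - 1 / 2 : ℝ) : ℂ) := by
    rw [div_eq_iff hba]
    simp only [Complex.real_smul, hα]
    push_cast
    ring
  rw [this, Complex.ofReal_im]

theorem eventually_mem_segment_iff {a b : ℂ} (hab : a ≠ b) :
    ∀ᶠ z in 𝓝 ((a + b) / 2),
      z ∈ segment ℝ a b ↔ ((z - (a + b) / 2) / (b - a)).im = 0 := by
  have hba : b - a ≠ 0 := sub_ne_zero.2 hab.symm
  have hc : ContinuousAt (fun z => |((z - (a + b) / 2) / (b - a)).re|) ((a + b) / 2) := by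
    fun_prop
  have h := hc.tendsto.eventually_lt_const (u := 1 / 2) (by simp)
  filter_upwards [h] with z hz
  refine ⟨im_eq_zero_of_mem_segment, fun him => ?_⟩
  set t := ((z - (a + b) / 2) / (b - a)).re with ht
  have hζ : (z - (a + b) / 2) / (b - a) = (t : ℂ) := by
    apply Complex.ext <;> simp [ht, him]
  rw [div_eq_iff hba] at hζ
  rw [abs_lt] at hz
  refine ⟨1 / 2 - t, 1 / 2 + t, by linarith, by linarith, by ring, ?_⟩
  simp only [Complex.real_smul]
  push_cast
  linear_combination -hζ

/-- What the planar argument needs to know about an arc `A` from `x` to `y`. The function `root` is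
a branch of the square root of `(x - z) * (y - z)` on the complement of `A`. Near the point `point`
of `A`, the arc is a straight line in direction `dir`, and `root` changes its sign across it, with
one-sided limits `limit` and `-limit`. -/
structure ArcRoot (A : Set ℂ) (x y : ℂ) where
  root : ℂ → ℂ
  point : ℂ
  dir : ℂ
  limit : ℂ
  isClosed : IsClosed A
  point_mem : point ∈ A
  point_ne_left : point ≠ x
  point_ne_right : point ≠ y
  left_mem : x ∈ A
  right_mem : y ∈ A
  dir_ne_zero : dir ≠ 0
  continuousAt : ∀ z ∉ A, ContinuousAt root z
  root_sq : ∀ z ∉ A, root z ^ 2 = (x - z) * (y - z)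
  tendsto_cobounded : Tendsto (fun z => root z / z) (Bornology.cobounded ℂ) (𝓝 (-1))
  tendsto_pos : Tendsto root (𝓝[{z | 0 < ((z - point) / dir).im}] point) (𝓝 limit)
  tendsto_neg : Tendsto root (𝓝[{z | ((z - point) / dir).im < 0}] point) (𝓝 (-limit))
  eventually_mem_iff : ∀ᶠ z in 𝓝 point, z ∈ A ↔ ((z - point) / dir).im = 0

theorem IsPolygonalArc.nonempty_arcRoot {A : Set ℂ} {x y : ℂ} (h : IsPolygonalArc A x y) :
    Nonempty (ArcRoot A x y) := by
  obtain ⟨m, p, hm, rfl, rfl, rfl, hne, hinter⟩ := h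
  have h01 : p 0 ≠ p 1 := hne 0 hm
  set q : ℂ := (p 0 + p 1) / 2 with hq
  have hq0 : q ∈ segment ℝ (p 0) (p 1) :=
    ⟨1 / 2, 1 / 2, by norm_num, by norm_num, by norm_num, by
      simp only [Complex.real_smul, hq]; push_cast; ring⟩
  have hqp0 : q ≠ p 0 := by
    intro h
    apply h01
    rw [hq] at h
    linear_combination -2 * h
  have hqp1 : q ≠ p 1 := by
    intro h
    apply h01
    rw [hq] at h
    linear_combination 2 * h
  have hqi : ∀ i, 0 < i → i < m → q ∉ segment ℝ (p i) (p (i + 1)) := by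
    intro i hi him hqi
    obtain ⟨h1, h2⟩ := hinter 0 i hi him ⟨hq0, hqi⟩
    subst h1
    exact hqp1 h2
  have hsub : ∀ i < m, segment ℝ (p i) (p (i + 1)) ⊆
      ⋃ i ∈ Set.Iio m, segment ℝ (p i) (p (i + 1)) := fun i hi =>
    Set.subset_biUnion_of_mem (u := fun i => segment ℝ (p i) (p (i + 1))) (Set.mem_Iio.2 hi)
  have hym : p m ∈ segment ℝ (p (m - 1)) (p (m - 1 + 1)) := by
    rw [Nat.sub_add_cancel hm]
    exact right_mem_segment ℝ _ _
  have hcob : ∀ᶠ z : ℂ in Bornology.cobounded ℂ, z ≠ 0 :=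
    Bornology.isBounded_def.1 (Bornology.isBounded_singleton (x := (0 : ℂ)))
  -- the factors for the segments after the first one are continuous at `q`
  have htail : ContinuousAt (fun z => (p 0 - z) *
      ∏ i ∈ Finset.range (m - 1), ratioSqrt (p (i + 1)) (p (i + 1 + 1)) z) q := by
    refine ContinuousAt.mul (by fun_prop) (tendsto_finsetProd _ fun i hi => ?_)
    have := Finset.mem_range.1 hi
    exact continuousAt_ratioSqrt (hqi (i + 1) (by omega) (by omega))
  have hroot : (fun z => (p 0 - z) * ∏ i ∈ Finset.range m, ratioSqrt (p i) (p (i + 1)) z) =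
      fun z => ((p 0 - z) *
        ∏ i ∈ Finset.range (m - 1), ratioSqrt (p (i + 1)) (p (i + 1 + 1)) z) *
          ratioSqrt (p 0) (p 1) z := by
    funext z
    obtain ⟨k, rfl⟩ : ∃ k, m = k + 1 := ⟨m - 1, by omega⟩
    rw [Finset.prod_range_succ', Nat.add_sub_cancel, mul_assoc]
  obtain ⟨hpos, hneg⟩ := tendsto_ratioSqrt_midpoint h01
  refine ⟨{
    root := fun z => (p 0 - z) * ∏ i ∈ Finset.range m, ratioSqrt (p i) (p (i + 1)) z
    point := q
    dir := p 1 - p 0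
    limit := ((p 0 - q) *
      ∏ i ∈ Finset.range (m - 1), ratioSqrt (p (i + 1)) (p (i + 1 + 1)) q) * Complex.I
    isClosed := (Set.finite_Iio m).isClosed_biUnion fun i _ => (isCompact_segment _ _).isClosed
    point_mem := hsub 0 hm hq0
    point_ne_left := hqp0
    point_ne_right := ?_
    left_mem := hsub 0 hm (left_mem_segment ℝ _ _)
    right_mem := hsub (m - 1) (by omega) hym
    dir_ne_zero := sub_ne_zero.2 h01.symm
    continuousAt := ?_
    root_sq := ?_
    tendsto_cobounded := ?_
    tendsto_pos := ?_
    tendsto_neg := ?_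
    eventually_mem_iff := ?_ }⟩
  · intro h
    rcases Nat.lt_or_ge 1 m with h1 | h1
    · exact hqi (m - 1) (by omega) (by omega) (h ▸ hym)
    · obtain rfl : m = 1 := by omega
      exact hqp1 h
  · intro z hz
    refine ContinuousAt.mul (by fun_prop) (tendsto_finsetProd _ fun i hi => ?_)
    exact continuousAt_ratioSqrt fun h => hz (hsub i (Finset.mem_range.1 hi) h)
  · intro z hz
    have hzi : ∀ i < m, p i - z ≠ 0 := fun i hi h =>
      hz (hsub i hi (by rw [← sub_eq_zero.1 h]; exact left_mem_segment ℝ _ _))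
    have hprod : ∀ k ≤ m,
        (p 0 - z) * ∏ i ∈ Finset.range k, (p (i + 1) - z) / (p i - z) = p k - z := by
      intro k
      induction k with
      | zero => simp
      | succ k ih =>
        intro hk
        rw [Finset.prod_range_succ, ← mul_assoc, ih (by omega), mul_div_cancel₀ _ (hzi k hk)]
    rw [mul_pow, ← Finset.prod_pow, Finset.prod_congr rfl fun i _ => ratioSqrt_sq _ _ _, sq,
      mul_assoc, hprod m le_rfl]
  · have h1 : Tendsto (fun z => (p 0 - z) / z) (Bornology.cobounded ℂ) (𝓝 (-1)) := by
      have := (tendsto_inv₀_cobounded (α := ℂ)).const_mul (p 0)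
      have := this.sub_const 1
      simp only [mul_zero, zero_sub] at this
      refine this.congr' ?_
      filter_upwards [hcob] with z hz
      field_simp
    have h2 := h1.mul (tendsto_finsetProd (Finset.range m)
      fun i _ => tendsto_ratioSqrt_cobounded (p i) (p (i + 1)))
    simp only [Finset.prod_const_one, mul_one] at h2
    refine h2.congr fun z => ?_
    ring
  · rw [hroot]
    exact (htail.tendsto.mono_left nhdsWithin_le_nhds).mul hpos
  · rw [hroot, ← mul_neg]
    exact (htail.tendsto.mono_left nhdsWithin_le_nhds).mul hneg
  · have hcl : IsClosed (⋃ i ∈ Set.Ioo 0 m, segment ℝ (p i) (p (i + 1))) :=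
      (Set.finite_Ioo 0 m).isClosed_biUnion fun i _ => (isCompact_segment _ _).isClosed
    have hqn : q ∉ ⋃ i ∈ Set.Ioo 0 m, segment ℝ (p i) (p (i + 1)) := by
      simp only [Set.mem_iUnion, not_exists]
      exact fun i hi => hqi i hi.1 hi.2
    filter_upwards [eventually_mem_segment_iff h01, hcl.isOpen_compl.mem_nhds hqn] with z hz hz'
    rw [← hz]
    refine ⟨fun h => ?_, fun h => hsub 0 hm h⟩
    simp only [Set.mem_iUnion] at h
    obtain ⟨i, hi, hzi⟩ := h
    rcases Nat.eq_zero_or_pos i with rfl | h0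
    · exact hzi
    · exact absurd (Set.mem_biUnion (t := fun i => segment ℝ (p i) (p (i + 1)))
        (show i ∈ Set.Ioo 0 m from ⟨h0, hi⟩) hzi) hz'

/-! ### Half-planes -/

/-- The open half-plane to the left of the line through `q` in direction `v`. -/
def halfPlane (q v : ℂ) : Set ℂ := {z | 0 < ((z - q) / v).im}

theorem halfPlane_neg (q v : ℂ) : halfPlane q (-v) = {z | ((z - q) / v).im < 0} := by
  ext z
  simp [halfPlane, div_neg]

theorem convex_halfPlane (q v : ℂ) : Convex ℝ (halfPlane q v) := by
  have : halfPlane q v = {z | (q / v).im < (z / v).im} := by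
    ext z
    simp [halfPlane, sub_div]
  rw [this]
  refine convex_halfSpace_gt (f := fun z : ℂ => (z / v).im) ⟨fun x y => ?_, fun c x => ?_⟩ _
  · rw [add_div, Complex.add_im]
  · rw [Complex.real_smul, mul_div_assoc, Complex.im_ofReal_mul, smul_eq_mul]

theorem neBot_nhdsWithin_halfPlane (q : ℂ) {v : ℂ} (hv : v ≠ 0) : (𝓝[halfPlane q v] q).NeBot := by
  rw [← mem_closure_iff_nhdsWithin_neBot]
  have h : Tendsto (fun t : ℝ => q + t * (v * Complex.I)) (𝓝[>] 0) (𝓝 q) := by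
    have : ContinuousAt (fun t : ℝ => q + t * (v * Complex.I)) 0 := by fun_prop
    simpa using this.tendsto.mono_left (nhdsWithin_le_nhds (s := Set.Ioi 0))
  refine mem_closure_of_tendsto h ?_
  filter_upwards [self_mem_nhdsWithin] with t ht
  have : (q + t * (v * Complex.I) - q) / v = t * Complex.I := by
    field_simp
    ring
  rw [halfPlane, Set.mem_ofPred_eq, this]
  simpa using ht

/-- If near `q` the closed set `K` is missed by a half-plane at `q`, then the points of the
half-plane near `q` lie in a single component of the complement of `K`. -/
theorem exists_component_halfPlane {K : Set ℂ} {q v : ℂ} (hv : v ≠ 0) {r : ℝ}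
    (hr : 0 < r) (h : ∀ z ∈ Metric.ball q r, z ∈ halfPlane q v → z ∉ K) :
    ∃ z ∈ Kᶜ, ∀ x ∈ Metric.ball q r, x ∈ halfPlane q v → x ∈ connectedComponentIn Kᶜ z := by
  have hne := neBot_nhdsWithin_halfPlane q hv
  have hmem : Metric.ball q r ∩ halfPlane q v ∈ 𝓝[halfPlane q v] q :=
    inter_mem (nhdsWithin_le_nhds (Metric.ball_mem_nhds q hr)) self_mem_nhdsWithin
  obtain ⟨z, hzr, hz⟩ := hne.nonempty_of_mem hmem
  refine ⟨z, h z hzr hz, fun x hxr hx => ?_⟩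
  exact ((convex_ball q r).inter (convex_halfPlane q v)).isPreconnected.subset_connectedComponentIn
    ⟨hzr, hz⟩ (fun y hy => h y hy.1 hy.2) ⟨hxr, hx⟩

variable {V : Type*} {G : SimpleGraph V} {H : G.Subgraph}

namespace PlaneDrawing

/-! ### Square roots along the edges of a drawing -/

/-- A choice, for each edge `e` of a drawing, of a square root of
`(pos a - z) * (pos b - z)`, where `e = s(a, b)`, that is branched along the arc of `e`, and of a
point of the arc at which the drawing is locally a straight line; compare `ArcRoot`. -/
structure EdgeRoots (D : PlaneDrawing H) where
  root : Sym2 V → ℂ → ℂ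
  point : Sym2 V → ℂ
  dir : Sym2 V → ℂ
  limit : Sym2 V → ℂ
  isClosed : ∀ e ∈ H.edgeSet, IsClosed (D.arc e)
  point_mem_iff : ∀ e ∈ H.edgeSet, ∀ e' ∈ H.edgeSet, point e ∈ D.arc e' ↔ e' = e
  point_ne_pos : ∀ e ∈ H.edgeSet, ∀ v ∈ H.verts, point e ≠ D.pos v
  dir_ne_zero : ∀ e ∈ H.edgeSet, dir e ≠ 0
  continuousAt : ∀ e ∈ H.edgeSet, ∀ z ∉ D.arc e, ContinuousAt (root e) z
  root_sq : ∀ ⦃a b⦄, H.Adj a b → ∀ z ∉ D.arc s(a, b),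
    root s(a, b) z ^ 2 = (D.pos a - z) * (D.pos b - z)
  tendsto_cobounded : ∀ e ∈ H.edgeSet,
    Tendsto (fun z => root e z / z) (Bornology.cobounded ℂ) (𝓝 (-1))
  tendsto_pos : ∀ e ∈ H.edgeSet,
    Tendsto (root e) (𝓝[halfPlane (point e) (dir e)] (point e)) (𝓝 (limit e))
  tendsto_neg : ∀ e ∈ H.edgeSet,
    Tendsto (root e) (𝓝[halfPlane (point e) (-dir e)] (point e)) (𝓝 (-limit e))
  eventually_mem_iff : ∀ e ∈ H.edgeSet,
    ∀ᶠ z in 𝓝 (point e), z ∈ D.arc e ↔ ((z - point e) / dir e).im = 0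

theorem nonempty_edgeRoots (D : PlaneDrawing H) : Nonempty D.EdgeRoots := by
  have key : ∀ e : Sym2 V, e ∈ H.edgeSet → ∃ (root : ℂ → ℂ) (point dir limit : ℂ),
      ∃ a b, ∃ R : ArcRoot (D.arc e) (D.pos a) (D.pos b), e = s(a, b) ∧
        root = R.root ∧ point = R.point ∧ dir = R.dir ∧ limit = R.limit := by
    intro e
    induction e with
    | _ a b =>
      intro he
      obtain ⟨R⟩ := (D.isArc (SimpleGraph.Subgraph.mem_edgeSet.1 he)).nonempty_arcRoot
      exact ⟨_, _, _, _, a, b, R, rfl, rfl, rfl, rfl, rfl⟩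
  choose! root point dir limit key using key
  choose a b R hab hroot hpoint hdir hlimit using key
  have hpos : ∀ e ∈ H.edgeSet, ∀ v ∈ H.verts, point e ≠ D.pos v := by
    intro e he v hv h
    have h1 : D.pos v ∈ D.arc e := by
      rw [← h, hpoint e he]
      exact (R e he).point_mem
    have h2 := D.mem_of_pos_mem e he v hv h1
    rw [hab e he, Sym2.mem_iff] at h2
    rw [hpoint e he] at h
    rcases h2 with rfl | rfl
    · exact (R e he).point_ne_left h
    · exact (R e he).point_ne_right h
  refine ⟨{
    root := root
    point := point
    dir := dir
    limit := limit
    isClosed := fun e he => (R e he).isClosed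
    point_mem_iff := ?_
    point_ne_pos := hpos
    dir_ne_zero := fun e he => hdir e he ▸ (R e he).dir_ne_zero
    continuousAt := fun e he => hroot e he ▸ (R e he).continuousAt
    root_sq := ?_
    tendsto_cobounded := fun e he => hroot e he ▸ (R e he).tendsto_cobounded
    tendsto_pos := ?_
    tendsto_neg := ?_
    eventually_mem_iff := ?_ }⟩
  · intro e he e' he'
    constructor
    · intro h
      by_contra hne
      have h1 : point e ∈ D.arc e := hpoint e he ▸ (R e he).point_mem
      obtain ⟨w, hw, hw'⟩ := D.arc_inter e he e' he' (Ne.symm hne) ⟨h1, h⟩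
      exact hpos e he w (H.mem_verts_of_mem_edge he hw.1) hw'.symm
    · rintro rfl
      exact hpoint _ he ▸ (R _ he).point_mem
  · intro x y hxy z hz
    have he : s(x, y) ∈ H.edgeSet := hxy
    rw [hroot _ he, (R _ he).root_sq z hz]
    rcases Sym2.eq_iff.1 (hab _ he) with ⟨h1, h2⟩ | ⟨h1, h2⟩
    · rw [← h1, ← h2]
    · rw [← h1, ← h2, mul_comm]
  · intro e he
    rw [hroot e he, hpoint e he, hdir e he, hlimit e he]
    exact (R e he).tendsto_pos
  · intro e he
    rw [hroot e he, hpoint e he, hdir e he, hlimit e he, halfPlane_neg]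
    exact (R e he).tendsto_neg
  · intro e he
    rw [hpoint e he, hdir e he]
    exact (R e he).eventually_mem_iff

theorem arc_subset_support (D : PlaneDrawing H) {e : Sym2 V} (he : e ∈ H.edgeSet) :
    D.arc e ⊆ D.support :=
  (Set.subset_biUnion_of_mem (u := fun e => D.arc e) he).trans Set.subset_union_right

theorem pos_mem_support (D : PlaneDrawing H) {v : V} (hv : v ∈ H.verts) : D.pos v ∈ D.support :=
  Or.inl ⟨v, hv, rfl⟩

namespace EdgeRoots

variable {D : PlaneDrawing H} (S : D.EdgeRoots)

/-- Near the chosen point of an edge the whole drawing is a straight line. -/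
theorem eventually_mem_support_iff [Finite V] {e : Sym2 V} (he : e ∈ H.edgeSet) :
    ∀ᶠ z in 𝓝 (S.point e), z ∈ D.support ↔ ((z - S.point e) / S.dir e).im = 0 := by
  have hcl : IsClosed (D.pos '' H.verts ∪ ⋃ e' ∈ H.edgeSet \ {e}, D.arc e') :=
    ((Set.toFinite H.verts).image _).isClosed.union
      ((Set.toFinite (H.edgeSet \ {e})).isClosed_biUnion fun e' he' => S.isClosed e' he'.1)
  have hq : S.point e ∉ D.pos '' H.verts ∪ ⋃ e' ∈ H.edgeSet \ {e}, D.arc e' := by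
    rintro (⟨v, hv, h⟩ | h)
    · exact S.point_ne_pos e he v hv h.symm
    · simp only [Set.mem_iUnion] at h
      obtain ⟨e', he', h⟩ := h
      exact he'.2 ((S.point_mem_iff e he e' he'.1).1 h)
  filter_upwards [S.eventually_mem_iff e he, hcl.isOpen_compl.mem_nhds hq] with z hz hz'
  rw [← hz]
  refine ⟨fun h => ?_, fun h => D.arc_subset_support he h⟩
  rcases h with h | h
  · exact absurd (Or.inl h) hz'
  · simp only [Set.mem_iUnion] at h
    obtain ⟨e', he', h⟩ := h
    by_cases hee : e' = e
    · exact hee ▸ h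
    · exact absurd (Or.inr (Set.mem_biUnion (t := D.arc) (⟨he', hee⟩ : e' ∈ H.edgeSet \ {e}) h)) hz'

/-- The two faces on either side of an edge (which may coincide). They are the only faces that have
the chosen point of the edge on their boundary. -/
theorem exists_sideFaces [Finite V] {e : Sym2 V} (he : e ∈ H.edgeSet) :
    ∃ F₁ F₂, D.IsFace F₁ ∧ D.IsFace F₂ ∧
      F₁ ∈ 𝓝[halfPlane (S.point e) (S.dir e)] (S.point e) ∧
      F₂ ∈ 𝓝[halfPlane (S.point e) (-S.dir e)] (S.point e) ∧
      ∀ F, D.IsFace F → (S.point e ∈ frontier F ↔ F = F₁ ∨ F = F₂) := by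
  obtain ⟨r, hr, hball⟩ := Metric.eventually_nhds_iff_ball.1 (S.eventually_mem_support_iff he)
  have hv := S.dir_ne_zero e he
  have hv' := neg_ne_zero.2 hv
  have hqmem : S.point e ∈ D.support :=
    D.arc_subset_support he ((S.point_mem_iff e he e he).2 rfl)
  obtain ⟨z₁, hz₁, h₁⟩ := exists_component_halfPlane (K := D.support) hv hr fun z hz hz' h =>
    (ne_of_gt hz') ((hball z hz).1 h)
  obtain ⟨z₂, hz₂, h₂⟩ := exists_component_halfPlane (K := D.support) hv' hr fun z hz hz' h => by
    rw [halfPlane_neg] at hz'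
    exact (ne_of_lt hz') ((hball z hz).1 h)
  have hm : ∀ v : ℂ, ∀ F : Set ℂ,
      (∀ x ∈ Metric.ball (S.point e) r, x ∈ halfPlane (S.point e) v → x ∈ F) →
      F ∈ 𝓝[halfPlane (S.point e) v] (S.point e) := by
    intro v F h
    filter_upwards [self_mem_nhdsWithin, nhdsWithin_le_nhds (Metric.ball_mem_nhds _ hr)]
      with x hx hx' using h x hx' hx
  have hfr : ∀ v : ℂ, v ≠ 0 → ∀ F, D.IsFace F → F ∈ 𝓝[halfPlane (S.point e) v] (S.point e) →
      S.point e ∈ frontier F := by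
    rintro v hv0 F ⟨z, hz, rfl⟩ hF
    have := neBot_nhdsWithin_halfPlane (S.point e) hv0
    refine ⟨?_, fun h => connectedComponentIn_subset _ _ (interior_subset h) hqmem⟩
    rw [mem_closure_iff_nhdsWithin_neBot]
    refine this.mono (le_inf nhdsWithin_le_nhds (le_principal_iff.2 hF))
  have hF₁ : D.IsFace (connectedComponentIn D.supportᶜ z₁) := ⟨z₁, hz₁, rfl⟩
  have hF₂ : D.IsFace (connectedComponentIn D.supportᶜ z₂) := ⟨z₂, hz₂, rfl⟩
  refine ⟨_, _, hF₁, hF₂, hm _ _ h₁, hm _ _ h₂, fun F hF => ⟨fun h => ?_, ?_⟩⟩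
  · obtain ⟨z, hz, rfl⟩ := hF
    obtain ⟨x, hx, hxF⟩ := mem_closure_iff_nhds.1 h.1 _ (Metric.ball_mem_nhds _ hr)
    have hxs : x ∉ D.support := connectedComponentIn_subset _ _ hxF
    rw [connectedComponentIn_eq hxF]
    rcases lt_trichotomy (((x - S.point e) / S.dir e).im) 0 with hlt | heq | hgt
    · right
      rw [connectedComponentIn_eq (h₂ x hx (by rw [halfPlane_neg]; exact hlt))]
    · exact absurd ((hball x hx).2 heq) hxs
    · left
      rw [connectedComponentIn_eq (h₁ x hx hgt)]
  · rintro (rfl | rfl)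
    · exact hfr _ hv _ hF₁ (hm _ _ h₁)
    · exact hfr _ hv' _ hF₂ (hm _ _ h₂)

/-! ### The parity index of a closed walk -/

/-- The product, over the steps from `a` to `b` of a walk, of the root of the edge divided by
`pos b - z`. For a closed walk this is `1` or `-1` off the drawing, according to the parity of the
winding number of the walk around `z`. -/
noncomputable def walkRoot {u v : V} (p : G.Walk u v) (z : ℂ) : ℂ :=
  (p.darts.map fun d => S.root d.edge z / (D.pos d.snd - z)).prod

@[simp]
theorem walkRoot_nil {u : V} (z : ℂ) : S.walkRoot (SimpleGraph.Walk.nil : G.Walk u u) z = 1 := rfl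

@[simp]
theorem walkRoot_cons {u v w : V} (h : G.Adj u v) (p : G.Walk v w) (z : ℂ) :
    S.walkRoot (SimpleGraph.Walk.cons h p) z =
      S.root s(u, v) z / (D.pos v - z) * S.walkRoot p z := by
  simp [walkRoot]

theorem pos_sub_ne_zero {v : V} (hv : v ∈ H.verts) {z : ℂ} (hz : z ∉ D.support) :
    D.pos v - z ≠ 0 :=
  fun h => hz (sub_eq_zero.1 h ▸ D.pos_mem_support hv)

theorem continuousAt_walkRoot {u v : V} (p : G.Walk u v) (hp : ∀ e ∈ p.edges, e ∈ H.edgeSet)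
    {z : ℂ} (hz : z ∉ D.support) : ContinuousAt (S.walkRoot p) z := by
  induction p with
  | nil => exact continuousAt_const
  | @cons a b c h p ih =>
    simp only [SimpleGraph.Walk.edges_cons, List.mem_cons, forall_eq_or_imp] at hp
    have hb : b ∈ H.verts := (SimpleGraph.Subgraph.mem_edgeSet.1 hp.1).snd_mem
    have h1 := S.continuousAt _ hp.1 z fun h => hz (D.arc_subset_support hp.1 h)
    have h2 : ContinuousAt (fun z => D.pos b - z) z := by fun_prop
    have := (h1.div h2 (pos_sub_ne_zero hb hz)).mul (ih hp.2)
    exact this.congr (Eventually.of_forall fun z => by simp [walkRoot_cons])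

theorem walkRoot_sq {u v : V} (p : G.Walk u v) (hp : ∀ e ∈ p.edges, e ∈ H.edgeSet)
    {z : ℂ} (hz : z ∉ D.support) :
    S.walkRoot p z ^ 2 * (D.pos v - z) = D.pos u - z := by
  induction p with
  | nil => simp
  | @cons a b c h p ih =>
    simp only [SimpleGraph.Walk.edges_cons, List.mem_cons, forall_eq_or_imp] at hp
    have hab := SimpleGraph.Subgraph.mem_edgeSet.1 hp.1
    have hb := pos_sub_ne_zero (D := D) hab.snd_mem hz
    rw [walkRoot_cons, mul_pow, mul_assoc, ih hp.2, div_pow,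
      S.root_sq hab z fun h => hz (D.arc_subset_support hp.1 h)]
    field_simp

theorem walkRoot_sq_eq_one {u : V} (p : G.Walk u u) (hp : ∀ e ∈ p.edges, e ∈ H.edgeSet)
    {z : ℂ} (hz : z ∉ D.support) : S.walkRoot p z ^ 2 = 1 := by
  cases p with
  | nil => simp
  | @cons _ b _ h p =>
    have hab : H.Adj u b := SimpleGraph.Subgraph.mem_edgeSet.1 (hp s(u, b) (by simp))
    have := S.walkRoot_sq _ hp hz
    exact mul_right_cancel₀ (pos_sub_ne_zero hab.fst_mem hz) (by rw [this, one_mul])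

theorem tendsto_walkRoot_cobounded {u v : V} (p : G.Walk u v)
    (hp : ∀ e ∈ p.edges, e ∈ H.edgeSet) :
    Tendsto (S.walkRoot p) (Bornology.cobounded ℂ) (𝓝 1) := by
  induction p with
  | nil => exact tendsto_const_nhds
  | @cons a b c h p ih =>
    simp only [SimpleGraph.Walk.edges_cons, List.mem_cons, forall_eq_or_imp] at hp
    have hne : ∀ x : ℂ, ∀ᶠ z in Bornology.cobounded ℂ, z ≠ x := fun x =>
      Bornology.isBounded_def.1 (Bornology.isBounded_singleton (x := x))
    have h1 : Tendsto (fun z => (D.pos b - z) / z) (Bornology.cobounded ℂ) (𝓝 (-1)) := by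
      have := ((tendsto_inv₀_cobounded (α := ℂ)).const_mul (D.pos b)).sub_const 1
      simp only [mul_zero, zero_sub] at this
      refine this.congr' ?_
      filter_upwards [hne 0] with z hz
      field_simp
    have h2 := ((S.tendsto_cobounded _ hp.1).div h1 (by norm_num)).mul (ih hp.2)
    rw [div_self (by norm_num), one_mul] at h2
    refine h2.congr' ?_
    filter_upwards [hne 0, hne (D.pos b)] with z hz hz'
    have := sub_ne_zero.2 hz'.symm
    simp only [walkRoot_cons, Pi.div_apply]
    field_simp

/-- Across an edge, the sign changes once for each time the walk traverses the edge. -/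
theorem exists_tendsto_walkRoot [DecidableEq V] {u v : V} (p : G.Walk u v)
    (hp : ∀ e ∈ p.edges, e ∈ H.edgeSet) {e : Sym2 V} (he : e ∈ H.edgeSet) :
    ∃ l, Tendsto (S.walkRoot p) (𝓝[halfPlane (S.point e) (S.dir e)] (S.point e)) (𝓝 l) ∧
      Tendsto (S.walkRoot p) (𝓝[halfPlane (S.point e) (-S.dir e)] (S.point e))
        (𝓝 ((-1) ^ p.edges.count e * l)) := by
  induction p with
  | nil => exact ⟨1, tendsto_const_nhds, by simpa using! tendsto_const_nhds⟩
  | @cons a b c h p ih =>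
    simp only [SimpleGraph.Walk.edges_cons, List.mem_cons, forall_eq_or_imp] at hp
    obtain ⟨l, hl, hl'⟩ := ih hp.2
    have hb : b ∈ H.verts := (SimpleGraph.Subgraph.mem_edgeSet.1 hp.1).snd_mem
    have hne : D.pos b - S.point e ≠ 0 := sub_ne_zero.2 (S.point_ne_pos e he b hb).symm
    have h2 : Tendsto (fun z => D.pos b - z) (𝓝 (S.point e)) (𝓝 (D.pos b - S.point e)) :=
      (show ContinuousAt (fun z => D.pos b - z) (S.point e) by fun_prop).tendsto
    have hfun : S.walkRoot (SimpleGraph.Walk.cons h p) =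
        fun z => S.root s(a, b) z / (D.pos b - z) * S.walkRoot p z :=
      funext fun z => S.walkRoot_cons h p z
    rw [hfun]
    by_cases hee : s(a, b) = e
    · subst hee
      refine ⟨_, ((S.tendsto_pos _ he).div (h2.mono_left nhdsWithin_le_nhds) hne).mul hl, ?_⟩
      convert ((S.tendsto_neg _ he).div (h2.mono_left nhdsWithin_le_nhds) hne).mul hl' using 2
      · rfl
      · rw [SimpleGraph.Walk.edges_cons, List.count_cons_self, pow_succ]
        ring
    · have h3 := (S.continuousAt _ hp.1 (S.point e)
        fun h => hee ((S.point_mem_iff e he _ hp.1).1 h)).tendsto.div h2 hne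
      refine ⟨_, (h3.mono_left nhdsWithin_le_nhds).mul hl, ?_⟩
      convert (h3.mono_left nhdsWithin_le_nhds).mul hl' using 2
      · rfl
      · rw [SimpleGraph.Walk.edges_cons, List.count_cons_of_ne (by simpa using hee)]
        ring

theorem walkRoot_eq_on_face {u : V} (p : G.Walk u u) (hp : ∀ e ∈ p.edges, e ∈ H.edgeSet)
    {F : Set ℂ} (hF : D.IsFace F) :
    (∀ z ∈ F, S.walkRoot p z = 1) ∨ (∀ z ∈ F, S.walkRoot p z = -1) := by
  obtain ⟨z, hz, rfl⟩ := hF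
  have hsub := connectedComponentIn_subset D.supportᶜ z
  exact isPreconnected_connectedComponentIn.eq_one_or_eq_neg_one_of_sq_eq
    (fun x hx => (S.continuousAt_walkRoot p hp (hsub hx)).continuousWithinAt)
    (fun x hx => S.walkRoot_sq_eq_one p hp (hsub hx))

open Classical in
/-- The parity index of a closed walk on a face. -/
noncomputable def faceParity {u : V} (p : G.Walk u u) (F : Set ℂ) : ZMod 2 :=
  if ∀ z ∈ F, S.walkRoot p z = 1 then 0 else 1

theorem walkRoot_eq_pow_faceParity {u : V} (p : G.Walk u u) (hp : ∀ e ∈ p.edges, e ∈ H.edgeSet)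
    {F : Set ℂ} (hF : D.IsFace F) {z : ℂ} (hz : z ∈ F) :
    S.walkRoot p z = (-1) ^ (S.faceParity p F).val := by
  unfold faceParity
  split_ifs with h
  · simp [h z hz]
  · simp [((S.walkRoot_eq_on_face p hp hF).resolve_left h) z hz, ZMod.val_one]

theorem faceParity_of_not_isBounded {u : V} (p : G.Walk u u)
    (hp : ∀ e ∈ p.edges, e ∈ H.edgeSet) {F : Set ℂ} (hF : D.IsFace F)
    (hb : ¬ Bornology.IsBounded F) : S.faceParity p F = 0 := by
  unfold faceParity
  rw [if_pos]
  refine (S.walkRoot_eq_on_face p hp hF).resolve_right fun h => hb ?_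
  have h1 := (S.tendsto_walkRoot_cobounded p hp).eventually_ne
    (show (1 : ℂ) ≠ -1 by norm_num)
  rw [Bornology.isBounded_def]
  filter_upwards [h1] with z hz hzF using hz (h z hzF)

theorem faceParity_add_faceParity [DecidableEq V] {u : V} (p : G.Walk u u)
    (hp : ∀ e ∈ p.edges, e ∈ H.edgeSet) {e : Sym2 V} (he : e ∈ H.edgeSet) {F₁ F₂ : Set ℂ}
    (hF₁ : D.IsFace F₁) (hF₂ : D.IsFace F₂)
    (h₁ : F₁ ∈ 𝓝[halfPlane (S.point e) (S.dir e)] (S.point e))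
    (h₂ : F₂ ∈ 𝓝[halfPlane (S.point e) (-S.dir e)] (S.point e)) :
    S.faceParity p F₁ + S.faceParity p F₂ = p.edges.count e := by
  obtain ⟨l, hl, hl'⟩ := S.exists_tendsto_walkRoot p hp he
  have := neBot_nhdsWithin_halfPlane (S.point e) (S.dir_ne_zero e he)
  have := neBot_nhdsWithin_halfPlane (S.point e) (neg_ne_zero.2 (S.dir_ne_zero e he))
  have e₁ : l = (-1) ^ (S.faceParity p F₁).val := by
    refine tendsto_nhds_unique (hl.congr' ?_) tendsto_const_nhds
    filter_upwards [h₁] with z hz using S.walkRoot_eq_pow_faceParity p hp hF₁ hz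
  have e₂ : (-1) ^ p.edges.count e * l = (-1) ^ (S.faceParity p F₂).val := by
    refine tendsto_nhds_unique (hl'.congr' ?_) tendsto_const_nhds
    filter_upwards [h₂] with z hz using S.walkRoot_eq_pow_faceParity p hp hF₂ hz
  rw [e₁] at e₂
  generalize S.faceParity p F₁ = i at *
  generalize S.faceParity p F₂ = j at *
  have hn : ((p.edges.count e : ℕ) : ZMod 2) = 0 ∧ (-1 : ℂ) ^ p.edges.count e = 1 ∨
      ((p.edges.count e : ℕ) : ZMod 2) = 1 ∧ (-1 : ℂ) ^ p.edges.count e = -1 := by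
    rcases Nat.even_or_odd (p.edges.count e) with h | h
    · exact Or.inl ⟨(ZMod.natCast_eq_zero_iff_even).2 h, h.neg_one_pow⟩
    · exact Or.inr ⟨(ZMod.natCast_eq_one_iff_odd).2 h, h.neg_one_pow⟩
  rcases hn with ⟨hn, hs⟩ | ⟨hn, hs⟩ <;> rw [hn] <;> rw [hs] at e₂ <;> clear hn hs e₁ <;>
    revert e₂ <;> fin_cases i <;> fin_cases j <;> norm_num [ZMod.val] <;> decide

end EdgeRoots

/-! ### The cycle space of a near-triangulation -/

/-- In a near-triangulation, the triangles generate the cycle space modulo 2: an edge function that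
sums to zero over each triangle sums to zero over each closed walk. Indeed, a closed walk is the sum
of the boundaries of the bounded faces on which its parity index is odd. -/
theorem IsNearTriangulation.sum_edges_eq_zero [Finite V] {D : PlaneDrawing H}
    (hD : D.IsNearTriangulation) (φ : Sym2 V → ZMod 2)
    (hφ : ∀ a b c, H.Adj a b → H.Adj b c → H.Adj c a → φ s(a, b) + φ s(b, c) + φ s(c, a) = 0)
    {u : V} (p : G.Walk u u) (hp : ∀ e ∈ p.edges, e ∈ H.edgeSet) : (p.edges.map φ).sum = 0 := by
  classical
  have := Fintype.ofFinite V
  obtain ⟨S⟩ := D.nonempty_edgeRoots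
  have hex := fun (e : Sym2 V) (he : e ∈ H.edgeSet) => S.exists_sideFaces he
  choose! F₁ F₂ hF₁ hF₂ hn₁ hn₂ hfr using hex
  let E : Finset (Sym2 V) := H.edgeSet.toFinset
  have hE : ∀ e, e ∈ E ↔ e ∈ H.edgeSet := fun e => Set.mem_toFinset
  let B : Finset (Set ℂ) := (E.image F₁ ∪ E.image F₂).filter Bornology.IsBounded
  have hBface : ∀ F ∈ B, D.IsFace F ∧ Bornology.IsBounded F := by
    intro F hF
    simp only [B, Finset.mem_filter, Finset.mem_union, Finset.mem_image] at hF
    obtain ⟨⟨e, he, rfl⟩ | ⟨e, he, rfl⟩, hb⟩ := hF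
    · exact ⟨hF₁ e ((hE e).1 he), hb⟩
    · exact ⟨hF₂ e ((hE e).1 he), hb⟩
  have hsum : ∀ F, D.IsFace F → (Bornology.IsBounded F → F ∈ B) →
      S.faceParity p F = ∑ F' ∈ B, if F' = F then S.faceParity p F' else 0 := by
    intro F hF hFB
    rw [Finset.sum_ite_eq']
    split_ifs with h
    · rfl
    · exact S.faceParity_of_not_isBounded p hp hF fun hb => h (hFB hb)
  -- the incidence of a bounded face with the edges is the indicator of a triangle
  have hinc : ∀ F ∈ B, ∑ e ∈ E, ((if F = F₁ e then 1 else 0) + (if F = F₂ e then 1 else 0)) * φ e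
      = 0 := by
    intro F hF
    obtain ⟨hface, hb⟩ := hBface F hF
    obtain ⟨a, b, c, hab, hbc, hca, hF'⟩ := hD F hface hb
    have hne1 : s(a, b) ≠ s(b, c) := by
      simp only [ne_eq, Sym2.eq_iff, not_or, not_and]
      exact ⟨fun h => absurd h hab.ne, fun h => absurd h.symm hca.ne⟩
    have hne2 : s(a, b) ≠ s(c, a) := by
      simp only [ne_eq, Sym2.eq_iff, not_or, not_and]
      exact ⟨fun h => absurd h.symm hca.ne, fun _ h => absurd h hbc.ne⟩
    have hne3 : s(b, c) ≠ s(c, a) := by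
      simp only [ne_eq, Sym2.eq_iff, not_or, not_and]
      exact ⟨fun h => absurd h hbc.ne, fun h => absurd h.symm hab.ne⟩
    let T : Finset (Sym2 V) := {s(a, b), s(b, c), s(c, a)}
    have hTE : T ⊆ E := by
      intro e he
      rw [hE]
      simp only [T, Finset.mem_insert, Finset.mem_singleton] at he
      rcases he with rfl | rfl | rfl
      · exact hab
      · exact hbc
      · exact hca
    have hmem : ∀ e ∈ E, (F = F₁ e ∨ F = F₂ e) ↔ e ∈ T := by
      intro e he
      have he' := (hE e).1 he
      rw [← hfr e he' F hface, hF', Set.mem_union, Set.mem_union,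
        S.point_mem_iff e he' _ hab, S.point_mem_iff e he' _ hbc, S.point_mem_iff e he' _ hca]
      simp only [T, Finset.mem_insert, Finset.mem_singleton]
      tauto
    -- the parity index of the triangle differs on the two sides of each of its edges
    let t : G.Walk a a := .cons hab.adj_sub (.cons hbc.adj_sub (.cons hca.adj_sub .nil))
    have ht : ∀ e ∈ t.edges, e ∈ H.edgeSet := by
      intro e he
      simp only [t, SimpleGraph.Walk.edges_cons, SimpleGraph.Walk.edges_nil, List.mem_cons,
        List.not_mem_nil, or_false] at he
      rcases he with rfl | rfl | rfl
      · exact hab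
      · exact hbc
      · exact hca
    have hdiff : ∀ e ∈ T, F₁ e ≠ F₂ e := by
      intro e he heq
      have he' := (hE e).1 (hTE he)
      have h := S.faceParity_add_faceParity t ht he' (hF₁ e he') (hF₂ e he') (hn₁ e he')
        (hn₂ e he')
      have hcount : t.edges.count e = 1 := by
        refine List.count_eq_one_of_mem ?_ ?_
        · simp [t, hne1, hne2, hne3]
        · simpa [t, T] using he
      rw [heq, hcount, CharTwo.add_self_eq_zero] at h
      simp at h
    have hterm : ∀ e ∈ E,
        ((if F = F₁ e then 1 else 0) + (if F = F₂ e then 1 else 0)) * φ e =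
          if e ∈ T then φ e else 0 := by
      intro e he
      by_cases heT : e ∈ T
      · rw [if_pos heT]
        have hd := hdiff e heT
        rcases (hmem e he).2 heT with h | h
        · rw [if_pos h, if_neg (fun h' => hd (h.symm.trans h')), add_zero, one_mul]
        · rw [if_pos h, if_neg (fun h' => hd (h'.symm.trans h)), zero_add, one_mul]
      · have := mt (hmem e he).1 heT
        rw [not_or] at this
        rw [if_neg this.1, if_neg this.2, if_neg heT, add_zero, zero_mul]
    rw [Finset.sum_congr rfl hterm, Finset.sum_ite_mem, Finset.inter_eq_right.2 hTE,
      Finset.sum_insert (by simp [hne1, hne2]), Finset.sum_insert (by simpa using hne3),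
      Finset.sum_singleton, ← add_assoc]
    exact hφ a b c hab hbc hca
  calc (p.edges.map φ).sum = ∑ e ∈ p.edges.toFinset, p.edges.count e • φ e :=
        Finset.sum_list_map_count _ _
    _ = ∑ e ∈ E, p.edges.count e • φ e := by
        refine Finset.sum_subset (fun e he => (hE e).2 (hp e (List.mem_toFinset.1 he))) ?_
        intro e _ he
        rw [List.count_eq_zero_of_not_mem (fun h => he (List.mem_toFinset.2 h)), zero_smul]
    _ = ∑ e ∈ E, ∑ F ∈ B,
          ((if F = F₁ e then S.faceParity p F else 0) +
            (if F = F₂ e then S.faceParity p F else 0)) * φ e := by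
        refine Finset.sum_congr rfl fun e he => ?_
        have he' := (hE e).1 he
        rw [nsmul_eq_mul, ← S.faceParity_add_faceParity p hp he' (hF₁ e he') (hF₂ e he')
          (hn₁ e he') (hn₂ e he'), ← Finset.sum_mul, Finset.sum_add_distrib,
          ← hsum (F₁ e) (hF₁ e he') fun hb => ?_, ← hsum (F₂ e) (hF₂ e he') fun hb => ?_]
        · exact Finset.mem_filter.2
            ⟨Finset.mem_union_right _ (Finset.mem_image_of_mem _ he), hb⟩
        · exact Finset.mem_filter.2
            ⟨Finset.mem_union_left _ (Finset.mem_image_of_mem _ he), hb⟩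
    _ = ∑ F ∈ B, S.faceParity p F *
          ∑ e ∈ E, ((if F = F₁ e then 1 else 0) + (if F = F₂ e then 1 else 0)) * φ e := by
        rw [Finset.sum_comm]
        refine Finset.sum_congr rfl fun F _ => ?_
        rw [Finset.mul_sum]
        refine Finset.sum_congr rfl fun e _ => ?_
        rw [← mul_assoc, mul_add, mul_ite, mul_ite, mul_one, mul_zero]
    _ = 0 := Finset.sum_eq_zero fun F hF => by rw [hinc F hF, mul_zero]

end PlaneDrawing

/-! ### Branches of a tree -/

section Tree

variable {ι : Type*} {T : SimpleGraph ι}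

/-- The vertices that can be reached from `s` without passing through `t`. In a tree these form,
for `s` adjacent to `t`, the component of `T - t` that contains `s`. -/
def branch (T : SimpleGraph ι) (t s : ι) : Set ι := {k | ∃ p : T.Walk s k, t ∉ p.support}

theorem self_mem_branch {t s : ι} (h : t ≠ s) : s ∈ branch T t s := ⟨.nil, by simpa using h⟩

theorem notMem_branch (t s : ι) : t ∉ branch T t s := fun ⟨p, hp⟩ => hp p.end_mem_support

theorem mem_branch_of_adj {t s k k' : ι} (hk : k ∈ branch T t s) (h : T.Adj k k') (hk' : k' ≠ t) :
    k' ∈ branch T t s := by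
  obtain ⟨p, hp⟩ := hk
  exact ⟨p.concat h, by simpa [SimpleGraph.Walk.support_concat, hp] using hk'.symm⟩

theorem exists_mem_branch (hT : T.Connected) {t k : ι} (hk : k ≠ t) :
    ∃ s, T.Adj t s ∧ k ∈ branch T t s := by
  classical
  obtain ⟨p⟩ := hT.preconnected t k
  have hp := p.bypass_isPath
  generalize p.bypass = q at hp
  cases q with
  | nil => exact absurd rfl hk
  | cons h q => exact ⟨_, h, q, ((SimpleGraph.Walk.cons_isPath_iff h q).1 hp).2⟩

theorem eq_of_mem_branch_of_mem_branch (hT : T.IsAcyclic) {t s s' k : ι} (hs : T.Adj t s)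
    (hs' : T.Adj t s') (hk : k ∈ branch T t s) (hk' : k ∈ branch T t s') : s = s' := by
  classical
  obtain ⟨p, hp⟩ := hk
  obtain ⟨q, hq⟩ := hk'
  let r := (p.append q.reverse).bypass
  have hr : t ∉ r.support := by
    intro h
    have := (p.append q.reverse).support_bypass_subset_support h
    rw [SimpleGraph.Walk.mem_support_append_iff] at this
    simp [hp, hq] at this
  have h := (hT.subsingleton_path t s').elim (⟨.cons hs r, (SimpleGraph.Walk.cons_isPath_iff _ _).2
    ⟨SimpleGraph.Walk.bypass_isPath _, hr⟩⟩ : T.Path t s') (SimpleGraph.Path.singleton hs')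
  have hl := congrArg (fun P : T.Path t s' => P.1.length) h
  simp only [SimpleGraph.Path.singleton, SimpleGraph.Walk.length_cons,
    SimpleGraph.Walk.length_nil, zero_add, Nat.add_eq_right] at hl
  exact SimpleGraph.Walk.eq_of_length_eq_zero hl

theorem eq_of_mem_branch_of_adj (hT : T.IsAcyclic) {t s k : ι} (hs : T.Adj t s)
    (hk : k ∈ branch T t s) (h : T.Adj t k) : k = s :=
  eq_of_mem_branch_of_mem_branch hT h hs (self_mem_branch h.ne) hk

theorem mem_branch_or_mem_branch (hT : T.Connected) {t s : ι} (hs : T.Adj t s) (k : ι) :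
    k ∈ branch T t s ∨ k ∈ branch T s t := by
  obtain ⟨p⟩ := hT.preconnected s k
  by_contra hk
  obtain ⟨d, -, h1, h2⟩ := p.exists_boundary_dart (branch T t s ∪ branch T s t)
    (Or.inl (self_mem_branch hs.ne)) hk
  by_cases ht : d.snd = t
  · exact h2 (Or.inr (by rw [ht]; exact self_mem_branch hs.ne'))
  by_cases hs' : d.snd = s
  · exact h2 (Or.inl (by rw [hs']; exact self_mem_branch hs.ne))
  · exact h2 (h1.imp (mem_branch_of_adj · d.adj ht) (mem_branch_of_adj · d.adj hs'))

theorem notMem_branch_of_mem_branch (hT : T.IsAcyclic) {t s k : ι} (hs : T.Adj t s)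
    (hk : k ∈ branch T t s) : k ∉ branch T s t := by
  rintro ⟨q, hq⟩
  obtain ⟨d, hd, h1, h2⟩ := q.exists_boundary_dart (branch T t s)ᶜ (notMem_branch t s)
    (not_not.2 hk)
  rw [Set.mem_compl_iff, not_not] at h2
  have ht : d.fst = t := by
    by_contra ht
    exact h1 (mem_branch_of_adj h2 d.adj.symm ht)
  have hds : d.snd = s := eq_of_mem_branch_of_adj hT hs h2 (ht ▸ d.adj)
  exact hq (hds ▸ q.dart_snd_mem_support_of_mem_darts hd)

theorem mem_branch_of_connected {N : Set ι} (hN : (T.induce N).Connected) {t s k k' : ι}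
    (ht : t ∉ N) (hk : k ∈ N) (hks : k ∈ branch T t s) (hk' : k' ∈ N) : k' ∈ branch T t s := by
  obtain ⟨p⟩ := hN.preconnected ⟨k, hk⟩ ⟨k', hk'⟩
  by_contra h
  obtain ⟨d, -, h1, h2⟩ := p.exists_boundary_dart {i | i.1 ∈ branch T t s} hks h
  exact h2 (mem_branch_of_adj h1 d.adj fun h => ht (h ▸ d.snd.2))

theorem mem_of_connected_of_mem_branch (hT : T.IsAcyclic) {N : Set ι}
    (hN : (T.induce N).Connected) {t s k : ι} (hs : T.Adj t s) (ht : t ∈ N) (hk : k ∈ N)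
    (hks : k ∈ branch T t s) : s ∈ N := by
  obtain ⟨p⟩ := hN.preconnected ⟨k, hk⟩ ⟨t, ht⟩
  obtain ⟨d, -, h1, h2⟩ := p.exists_boundary_dart {i | i.1 ∈ branch T t s} hks
    (notMem_branch t s)
  have hadj : T.Adj d.fst.1 d.snd.1 := d.adj
  have hd : d.snd.1 = t := by
    by_contra hd
    exact h2 (mem_branch_of_adj h1 hadj hd)
  have := eq_of_mem_branch_of_adj hT hs h1 (hd ▸ hadj.symm)
  exact this ▸ d.fst.2

/-- If every vertex of a finite tree points to a neighbour, then two adjacent vertices point to each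
other, since there are fewer edges than vertices. -/
theorem exists_mutual_neighbors [Finite ι] (hT : T.IsTree) (f : ι → ι)
    (hf : ∀ t, T.Adj t (f t)) : ∃ t, f (f t) = t := by
  classical
  have := Fintype.ofFinite ι
  have hcard : T.edgeFinset.card < (Finset.univ : Finset ι).card := by
    have := hT.card_edgeFinset
    rw [Finset.card_univ]
    omega
  obtain ⟨t, -, t', -, hne, h⟩ := Finset.exists_ne_map_eq_of_card_lt_of_maps_to hcard
    (f := fun t => s(t, f t)) (fun t _ => by simpa using hf t)
  rcases Sym2.eq_iff.1 h with ⟨h1, -⟩ | ⟨h1, h2⟩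
  · exact absurd h1 hne
  · exact ⟨t, by rw [h2, ← h1]⟩

end Tree

/-! ### Tree decompositions and parity functionals -/

section Parity

/-- `χ` vanishes outside `X` and is constant on each component of the graph induced by `X \ Z`. -/
structure IsComponentwise (G : SimpleGraph V) (X Z : Set V) (χ : V → ZMod 2) : Prop where
  eq_zero : ∀ v ∉ X, χ v = 0
  eq_of_adj : ∀ ⦃a b⦄, a ∈ X \ Z → b ∈ X \ Z → G.Adj a b → χ a = χ b

/-- Suppose that there are parity functionals `par l`, some of which are `good` with respect to a
set `Z`, such that the good ones take the value `1` on `X \ Z`, and agree on the unions of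
components of the graph induced by `X \ Z`. Then for any tree decomposition (over the tree `T`, with
bags `B`) of the graph induced by `X`, none is good with respect to some bag.

Otherwise, at each node some branch carries odd parity, so for some edge of the tree both of its
sides carry odd parity; but together they carry the parity of the complement of the separator that
belongs to this edge, which is odd. -/
theorem exists_bag_forall_not_good {ι Λ : Type*} [Finite ι] {T : SimpleGraph ι} (hT : T.IsTree)
    {X : Set V} {B : ι → Set V} (hBX : ∀ t, B t ⊆ X) (hcover : ∀ x ∈ X, ∃ t, x ∈ B t)
    (hadj : ∀ x ∈ X, ∀ y ∈ X, G.Adj x y → ∃ t, x ∈ B t ∧ y ∈ B t)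
    (hconn : ∀ x ∈ X, (T.induce {t | x ∈ B t}).Connected)
    (good : Set V → Λ → Prop) (par : Λ → (V → ZMod 2) →+ ZMod 2)
    (hmono : ∀ Z Z' l, Z ⊆ Z' → good Z' l → good Z l)
    (hone : ∀ Z l, good Z l → par l ((X \ Z).indicator 1) = 1)
    (heq : ∀ Z l l' χ, IsComponentwise G X Z χ → good Z l → good Z l' → par l χ = par l' χ) :
    ∃ t, ∀ l, ¬ good (B t) l := by
  classical
  have := Fintype.ofFinite ι
  by_contra! hgood
  choose l hl using hgood
  -- the part of `X` behind the neighbour `s` of the node `t`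
  let K : ι → ι → Set V := fun t s => {x | x ∉ B t ∧ ∃ k ∈ branch T t s, x ∈ B k}
  let χ : ι → ι → V → ZMod 2 := fun t s => (K t s).indicator 1
  have hKX : ∀ t s, K t s ⊆ X := fun t s x hx => by
    obtain ⟨-, k, -, hk⟩ := hx
    exact hBX k hk
  have hχ : ∀ t s x, χ t s x = if x ∈ K t s then 1 else 0 := fun t s x => by
    simp [χ, Set.indicator_apply]
  have hcomp : ∀ t s, T.Adj t s → IsComponentwise G X (B t ∩ B s) (χ t s) := by
    intro t s hts
    refine ⟨fun v hv => Set.indicator_of_notMem (fun h => hv (hKX t s h)) _, ?_⟩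
    have key : ∀ a b, a ∈ X \ (B t ∩ B s) → b ∈ X \ (B t ∩ B s) → G.Adj a b →
        a ∈ K t s → b ∈ K t s := by
      rintro a b ha hb hab ⟨hat, k, hk, hak⟩
      obtain ⟨k', hak', hbk'⟩ := hadj a ha.1 b hb.1 hab
      have hk' : k' ∈ branch T t s :=
        mem_branch_of_connected (hconn a ha.1) (N := {t | a ∈ B t}) hat hak hk hak'
      refine ⟨fun hbt => hb.2 ⟨hbt, ?_⟩, k', hk', hbk'⟩
      exact mem_of_connected_of_mem_branch hT.2 (hconn b hb.1) (N := {t | b ∈ B t}) hts hbt hbk' hk'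
    intro a b ha hb hab
    rw [hχ, hχ]
    exact if_congr ⟨key a b ha hb hab, key b a hb ha hab.symm⟩ rfl rfl
  have hodd : ∀ t, ∃ s, T.Adj t s ∧ par (l t) (χ t s) = 1 := by
    intro t
    by_contra! h
    have hsum : (X \ B t).indicator 1 = ∑ s ∈ Finset.univ.filter (T.Adj t), χ t s := by
      funext x
      rw [Finset.sum_apply]
      by_cases hx : x ∈ X \ B t
      · rw [Set.indicator_of_mem hx, Pi.one_apply]
        obtain ⟨k, hk⟩ := hcover x hx.1
        obtain ⟨s, hs, hks⟩ := exists_mem_branch hT.1 (fun h => hx.2 (h ▸ hk) : k ≠ t)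
        rw [Finset.sum_eq_single_of_mem s (by simpa using hs), hχ,
          if_pos ⟨hx.2, k, hks, hk⟩]
        intro s' hs' hne
        rw [hχ, if_neg]
        rintro ⟨-, k', hk', hxk'⟩
        have hk'' := mem_branch_of_connected (hconn x hx.1) (N := {t | x ∈ B t}) hx.2 hk hks hxk'
        exact hne (eq_of_mem_branch_of_mem_branch hT.2 (by simpa using hs') hs hk' hk'')
      · rw [Set.indicator_of_notMem hx, Finset.sum_eq_zero]
        intro s _
        rw [hχ, if_neg]
        exact fun hxK => hx ⟨hKX t s hxK, hxK.1⟩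
    have h1 := hone _ _ (hl t)
    rw [hsum, map_sum, Finset.sum_eq_zero] at h1
    · exact zero_ne_one h1
    · intro s hs
      exact (by decide : ∀ c : ZMod 2, c ≠ 1 → c = 0) _ (h s (by simpa using hs))
  choose f hf hf1 using hodd
  obtain ⟨t, ht⟩ := exists_mutual_neighbors hT f hf
  have hts := hf t
  have h1 := hf1 t
  have h2 := hf1 (f t)
  rw [ht] at h2
  generalize f t = s at *
  have hgt := hmono (B t ∩ B s) _ _ Set.inter_subset_left (hl t)
  have hgs := hmono (B t ∩ B s) _ _ Set.inter_subset_right (hl s)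
  have hst := hcomp s t hts.symm
  rw [Set.inter_comm] at hst
  rw [heq _ _ _ _ hst hgs hgt] at h2
  have hsum : (X \ (B t ∩ B s)).indicator 1 = χ t s + χ s t := by
    funext x
    rw [Pi.add_apply, hχ, hχ]
    by_cases hxX : x ∈ X
    · by_cases hxt : x ∈ B t
      · have hK : x ∉ K t s := fun h => h.1 hxt
        by_cases hxs : x ∈ B s
        · have hK' : x ∉ K s t := fun h => h.1 hxs
          simp [hxt, hxs, hK, hK']
        · have hK' : x ∈ K s t := ⟨hxs, t, self_mem_branch hts.ne', hxt⟩
          simp [hxX, hxs, hK, hK']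
      · by_cases hxs : x ∈ B s
        · have hK : x ∈ K t s := ⟨hxt, s, self_mem_branch hts.ne, hxs⟩
          have hK' : x ∉ K s t := fun h => h.1 hxs
          simp [hxX, hxt, hK, hK']
        · obtain ⟨k, hk⟩ := hcover x hxX
          rcases mem_branch_or_mem_branch hT.1 hts k with hks | hks
          · have hK : x ∈ K t s := ⟨hxt, k, hks, hk⟩
            have hK' : x ∉ K s t := fun ⟨_, k', hk', hxk'⟩ =>
              notMem_branch_of_mem_branch hT.2 hts (mem_branch_of_connected (hconn x hxX)
                (N := {t | x ∈ B t}) hxt hk hks hxk') hk'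
            simp [hxX, hxt, hK, hK']
          · have hK' : x ∈ K s t := ⟨hxs, k, hks, hk⟩
            have hK : x ∉ K t s := fun ⟨_, k', hk', hxk'⟩ =>
              notMem_branch_of_mem_branch hT.2 hts.symm (mem_branch_of_connected (hconn x hxX)
                (N := {t | x ∈ B t}) hxs hk hks hxk') hk'
            simp [hxX, hxt, hK, hK']
    · rw [Set.indicator_of_notMem (fun h => hxX h.1), if_neg fun h => hxX (hKX _ _ h),
        if_neg fun h => hxX (hKX _ _ h), add_zero]
  have h3 := hone _ _ hgt
  rw [hsum, map_add, h1, h2] at h3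
  exact absurd h3 (by decide)

/-! ### The parity with which a walk crosses a separator -/

open Classical in
/-- The edge function that assigns, to an edge that leaves `T`, the value of `χ` at its end outside
`T` (if `χ` vanishes on `T`). -/
noncomputable def crossing (T : Set V) (χ : V → ZMod 2) : Sym2 V → ZMod 2 :=
  Sym2.lift ⟨fun a b => (if a ∈ T then χ b else 0) + (if b ∈ T then χ a else 0),
    fun _ _ => add_comm _ _⟩

open Classical in
theorem crossing_mk (T : Set V) (χ : V → ZMod 2) (a b : V) :
    crossing T χ s(a, b) = (if a ∈ T then χ b else 0) + (if b ∈ T then χ a else 0) := rfl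

theorem crossing_add (T : Set V) (χ χ' : V → ZMod 2) :
    crossing T (χ + χ') = crossing T χ + crossing T χ' := by
  funext e
  induction e with
  | _ a b =>
    simp only [Pi.add_apply, crossing_mk]
    split_ifs <;> ring

/-- The sum of `crossing T χ` along a walk, as an additive function of `χ`. -/
noncomputable def walkParity (T : Set V) {u v : V} (p : G.Walk u v) : (V → ZMod 2) →+ ZMod 2 :=
  AddMonoidHom.mk' (fun χ => (p.edges.map (crossing T χ)).sum) fun χ χ' => by
    rw [crossing_add, ← List.sum_map_add]
    rfl

theorem walkParity_apply (T : Set V) {u v : V} (p : G.Walk u v) (χ : V → ZMod 2) :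
    walkParity T p χ = (p.edges.map (crossing T χ)).sum := rfl

variable {T X Z : Set V} {χ : V → ZMod 2}

theorem crossing_triangle (hTX : Disjoint T X)
    (hout : ∀ a b, G.Adj a b → a ∈ T → b ∉ T → b ∈ X) (hχ : IsComponentwise G X Z χ) {a b c : V}
    (hab : G.Adj a b) (hbc : G.Adj b c) (hca : G.Adj c a) (ha : a ∉ Z) (hb : b ∉ Z) (hc : c ∉ Z) :
    crossing T χ s(a, b) + crossing T χ s(b, c) + crossing T χ s(c, a) = 0 := by
  have h0 : ∀ v ∈ T, χ v = 0 := fun v hv => hχ.eq_zero v (Set.disjoint_left.1 hTX hv)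
  have heq : ∀ x y z, x ∈ T → y ∉ T → z ∉ T → G.Adj x y → G.Adj x z → G.Adj y z → y ∉ Z → z ∉ Z →
      χ y = χ z := fun x y z hx hy hz hxy hxz hyz hy' hz' =>
    hχ.eq_of_adj ⟨hout x y hxy hx hy, hy'⟩ ⟨hout x z hxz hx hz, hz'⟩ hyz
  simp only [crossing_mk]
  by_cases hat : a ∈ T <;> by_cases hbt : b ∈ T <;> by_cases hct : c ∈ T <;>
    simp only [hat, hbt, hct, if_true, if_false, h0, add_zero, zero_add, CharTwo.add_self_eq_zero]
  · rw [heq a b c hat hbt hct hab hca.symm hbc hb hc, CharTwo.add_self_eq_zero]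
  · rw [heq b a c hbt hat hct hab.symm hbc hca.symm ha hc, CharTwo.add_self_eq_zero]
  · rw [heq c a b hct hat hbt hca hbc.symm hab ha hb, CharTwo.add_self_eq_zero]

/-- A walk that avoids `Z` leaves or enters `T` through `X \ Z` an odd number of times if and only
if exactly one of its ends is in `T`. -/
theorem walkParity_indicator (hTX : Disjoint T X)
    (hout : ∀ a b, G.Adj a b → a ∈ T → b ∉ T → b ∈ X) {u v : V} (p : G.Walk u v)
    (hp : ∀ x ∈ p.support, x ∉ Z) :
    walkParity T p ((X \ Z).indicator 1) = T.indicator 1 u + T.indicator 1 v := by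
  classical
  rw [walkParity_apply]
  induction p with
  | nil => simp [CharTwo.add_self_eq_zero]
  | @cons a b c h p ih =>
    simp only [SimpleGraph.Walk.support_cons, List.mem_cons, forall_eq_or_imp] at hp
    have hb : b ∉ Z := hp.2 b p.start_mem_support
    rw [SimpleGraph.Walk.edges_cons, List.map_cons, List.sum_cons, ih hp.2, crossing_mk]
    have e1 : ∀ x ∈ T, (X \ Z).indicator (1 : V → ZMod 2) x = 0 := fun x hx =>
      Set.indicator_of_notMem (fun h => Set.disjoint_left.1 hTX hx h.1) _
    have e2 : ∀ x ∈ X, x ∉ Z → (X \ Z).indicator (1 : V → ZMod 2) x = 1 := fun x hx hx' =>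
      Set.indicator_of_mem (s := X \ Z) ⟨hx, hx'⟩ _
    by_cases hat : a ∈ T <;> by_cases hbt : b ∈ T
    · simp [hat, hbt, e1]
    · simp [hat, hbt, e2 b (hout a b h hat hbt) hb]
    · simp [hat, hbt, e2 a (hout b a h.symm hbt hat) hp.1, ← add_assoc,
        CharTwo.add_self_eq_zero]
    · simp [hat, hbt]

theorem walkParity_eq_zero (h : ∀ v ∈ T, χ v = 0) {K : G.Subgraph}
    (hK : K.verts ⊆ T ∨ Disjoint K.verts T) {u v : V} (p : G.Walk u v) (hp : p.toSubgraph ≤ K) :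
    walkParity T p χ = 0 := by
  rw [walkParity_apply]
  refine List.sum_eq_zero fun c hc => ?_
  obtain ⟨e, he, rfl⟩ := List.mem_map.1 hc
  induction e with
  | _ a b =>
    have hab : K.Adj a b := hp.2 (p.mem_edges_toSubgraph.2 he)
    rw [crossing_mk]
    rcases hK with hK | hK
    · simp [hK hab.fst_mem, hK hab.snd_mem, h]
    · simp [Set.disjoint_left.1 hK hab.fst_mem, Set.disjoint_left.1 hK hab.snd_mem]

theorem walkParity_append {u v w : V} (p : G.Walk u v) (q : G.Walk v w) :
    walkParity T (p.append q) χ = walkParity T p χ + walkParity T q χ := by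
  simp [walkParity_apply]

theorem walkParity_reverse {u v : V} (p : G.Walk u v) :
    walkParity T p.reverse χ = walkParity T p χ := by
  simp [walkParity_apply, List.sum_reverse]

theorem IsPathBetween.exists_walk {K : G.Subgraph} {x y : V} (hK : IsPathBetween K x y) {a b : V}
    (ha : a ∈ K.verts) (hb : b ∈ K.verts) : ∃ q : G.Walk a b, q.toSubgraph ≤ K := by
  obtain ⟨p, -, rfl⟩ := hK
  exact (SimpleGraph.Subgraph.connected_iff_forall_exists_walk_subgraph _).1
    p.toSubgraph_connected |>.2 ha hb

/-- Two walks between the sides inside a row or column that avoids `Z` have the same parity: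
together with parts of the sides they form a closed walk, which is a sum of triangles. -/
theorem IsSlabLayer.walkParity_eq [Finite V] {S₁ S₂ H : G.Subgraph} (hH : IsSlabLayer S₁ S₂ H)
    (hTX : Disjoint T X) (hout : ∀ a b, G.Adj a b → a ∈ T → b ∉ T → b ∈ X)
    (hS₁ : S₁.verts ⊆ T) (hS₂ : Disjoint S₂.verts T) (hχ : IsComponentwise G X Z χ)
    (hZ : Disjoint Z H.verts) {u v u' v' : V} (p : G.Walk u v) (p' : G.Walk u' v')
    (hp : p.toSubgraph ≤ H) (hp' : p'.toSubgraph ≤ H) (hu : u ∈ S₁.verts) (hu' : u' ∈ S₁.verts)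
    (hv : v ∈ S₂.verts) (hv' : v' ∈ S₂.verts) : walkParity T p χ = walkParity T p' χ := by
  obtain ⟨D, hD, hS⟩ := hH
  obtain ⟨⟨x₁, y₁, hP₁⟩, -⟩ := hS S₁ (Or.inl rfl)
  obtain ⟨⟨x₂, y₂, hP₂⟩, -⟩ := hS S₂ (Or.inr rfl)
  have hmem : ∀ {a b c : V} (r : G.Walk a b), r.toSubgraph ≤ H → c ∈ r.support → c ∈ H.verts :=
    fun r hr hc => hr.1 (r.mem_verts_toSubgraph.2 hc)
  obtain ⟨q₂, hq₂⟩ := hP₂.exists_walk (a := v) (b := v') ⟨hmem p hp p.end_mem_support, hv⟩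
    ⟨hmem p' hp' p'.end_mem_support, hv'⟩
  obtain ⟨q₁, hq₁⟩ := hP₁.exists_walk (a := u') (b := u)
    ⟨hmem p' hp' p'.start_mem_support, hu'⟩ ⟨hmem p hp p.start_mem_support, hu⟩
  have h0 : ∀ v ∈ T, χ v = 0 := fun v hv => hχ.eq_zero v (Set.disjoint_left.1 hTX hv)
  have hz₁ : walkParity T q₁ χ = 0 := walkParity_eq_zero h0
    (Or.inl (Set.inter_subset_right.trans hS₁)) q₁ hq₁
  have hz₂ : walkParity T q₂ χ = 0 := walkParity_eq_zero h0
    (Or.inr (hS₂.mono_left Set.inter_subset_right)) q₂ hq₂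
  have hedges : ∀ {a b : V} (r : G.Walk a b), r.toSubgraph ≤ H → ∀ e ∈ r.edges, e ∈ H.edgeSet :=
    fun r hr e he => SimpleGraph.Subgraph.edgeSet_mono hr (r.mem_edges_toSubgraph.2 he)
  have hZ' : ∀ {a}, a ∈ H.verts → a ∉ Z := fun ha h => Set.disjoint_left.1 hZ h ha
  have hclosed := hD.sum_edges_eq_zero (crossing T χ)
    (fun a b c hab hbc hca => crossing_triangle hTX hout hχ hab.adj_sub hbc.adj_sub hca.adj_sub
      (hZ' hab.fst_mem) (hZ' hbc.fst_mem) (hZ' hca.fst_mem))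
    (((p.append q₂).append p'.reverse).append q₁) (by
      intro e he
      simp only [SimpleGraph.Walk.edges_append, SimpleGraph.Walk.edges_reverse, List.mem_append,
        List.mem_reverse] at he
      rcases he with ((he | he) | he) | he
      · exact hedges p hp e he
      · exact hedges q₂ (hq₂.trans inf_le_left) e he
      · exact hedges p' hp' e he
      · exact hedges q₁ (hq₁.trans inf_le_left) e he)
  rw [← walkParity_apply, walkParity_append, walkParity_append, walkParity_append,
    walkParity_reverse, hz₁, hz₂, add_zero, add_zero] at hclosed
  exact CharTwo.add_eq_zero.1 hclosed

theorem exists_disjoint_of_encard_lt {n : ℕ} {A : Fin n → Set V}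
    (hA : ∀ i j, i ≠ j → Disjoint (A i) (A j)) {Z : Set V} (hZ : Z.encard < n) :
    ∃ i, Disjoint Z (A i) := by
  by_contra! h
  simp only [Set.not_disjoint_iff] at h
  choose z hz hzA using h
  have hinj : Function.Injective z := by
    intro i j hij
    by_contra hne
    exact Set.disjoint_left.1 (hA i j hne) (hzA i) (hij ▸ hzA j)
  have hle : (Set.range z).encard ≤ Z.encard := Set.encard_le_encard (Set.range_subset_iff.2 hz)
  rw [← Set.image_univ, hinj.encard_image, Set.encard_univ, ENat.card_eq_coe_fintype_card,
    Fintype.card_fin] at hle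
  exact absurd hZ (not_lt.2 hle)

/-- A set that separates the sides of an `(n × n)`-slab induces a subgraph of tree-width at least
`n - 1`. -/
theorem IsSlab.le_of_treewidthAtMost [Finite V] {S₁ S₂ : G.Subgraph} {n : ℕ}
    {R C : Fin n → G.Subgraph} (hslab : IsSlab G S₁ S₂ n R C) (hX₁ : Disjoint X S₁.verts)
    (hX : ∀ u ∈ S₁.verts, ∀ v ∈ S₂.verts, ∀ p : G.Walk u v, p.IsPath → ∃ x ∈ p.support, x ∈ X)
    {w : ℕ} (hw : TreewidthAtMost (G.induce X) w) : n ≤ w + 1 := by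
  classical
  by_contra! hlt
  obtain ⟨ι, hι, D, hD⟩ := hw
  -- the vertices that can be reached from the first side without meeting `X`
  let T : Set V := {v | ∃ u ∈ S₁.verts, ∃ p : G.Walk u v, ∀ x ∈ p.support, x ∉ X}
  have hS₁ : S₁.verts ⊆ T := fun u hu =>
    ⟨u, hu, .nil, by simpa using fun h => Set.disjoint_left.1 hX₁ h hu⟩
  have hS₂ : Disjoint S₂.verts T := by
    rw [Set.disjoint_left]
    rintro v hv ⟨u, hu, p, hp⟩
    obtain ⟨x, hx, hxX⟩ := hX u hu v hv p.bypass p.bypass_isPath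
    exact hp x (p.support_bypass_subset_support hx) hxX
  have hTX : Disjoint T X := Set.disjoint_left.2 fun v ⟨_, _, p, hp⟩ => hp v p.end_mem_support
  have hout : ∀ a b, G.Adj a b → a ∈ T → b ∉ T → b ∈ X := by
    rintro a b hab ⟨u, hu, p, hp⟩ hb
    by_contra hbX
    refine hb ⟨u, hu, p.concat hab, fun x hx => ?_⟩
    rw [SimpleGraph.Walk.support_concat, List.mem_append, List.mem_singleton] at hx
    rcases hx with hx | rfl
    · exact hp x hx
    · exact hbX
  choose u hu v hv P _ hP using hslab.inter_path
  have hPR : ∀ i j, (P i j).toSubgraph ≤ R i := fun i j => (hP i j).le.trans inf_le_left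
  have hPC : ∀ i j, (P i j).toSubgraph ≤ C j := fun i j => (hP i j).le.trans inf_le_right
  obtain ⟨t, ht⟩ := exists_bag_forall_not_good (G := G) D.isTree (X := X)
    (B := fun t => Subtype.val '' D.bag t) (Λ := Fin n × Fin n)
    (by rintro t _ ⟨x, -, rfl⟩; exact x.2)
    (fun x hx => (D.exists_mem_bag ⟨x, hx⟩).imp fun t ht => ⟨_, ht, rfl⟩)
    (fun x hx y hy hxy => (D.exists_adj_bag (u := ⟨x, hx⟩) (v := ⟨y, hy⟩) hxy).imp
      fun t ht => ⟨⟨_, ht.1, rfl⟩, ⟨_, ht.2, rfl⟩⟩)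
    (fun x hx => by
      have : {t | x ∈ Subtype.val '' D.bag t} = {t | (⟨x, hx⟩ : X) ∈ D.bag t} := by
        ext t
        simp [hx]
      rw [this]
      exact D.connected ⟨x, hx⟩)
    (fun Z l => Disjoint Z (R l.1).verts ∧ Disjoint Z (C l.2).verts)
    (fun l => walkParity T (P l.1 l.2))
    (fun Z Z' l hZ h => ⟨h.1.mono_left hZ, h.2.mono_left hZ⟩)
    (fun Z l h => by
      rw [walkParity_indicator hTX hout _ fun x hx hxZ =>
        Set.disjoint_left.1 h.1 hxZ ((hPR _ _).1 ((P _ _).mem_verts_toSubgraph.2 hx)),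
        Set.indicator_of_mem (hS₁ (hu _ _)),
        Set.indicator_of_notMem (Set.disjoint_left.1 hS₂ (hv _ _)), add_zero, Pi.one_apply])
    (fun Z l l' χ hχ h h' =>
      ((hslab.row_layer l.1).walkParity_eq hTX hout hS₁ hS₂ hχ h.1 (P l.1 l.2) (P l.1 l'.2)
        (hPR _ _) (hPR _ _) (hu _ _) (hu _ _) (hv _ _) (hv _ _)).trans
      ((hslab.col_layer l'.2).walkParity_eq hTX hout hS₁ hS₂ hχ h'.2 (P l.1 l'.2) (P l'.1 l'.2)
        (hPC _ _) (hPC _ _) (hu _ _) (hu _ _) (hv _ _) (hv _ _)))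
  have hcard : (Subtype.val '' D.bag t).encard < n := by
    rw [Subtype.val_injective.encard_image]
    exact (hD t).trans_lt (by exact_mod_cast hlt)
  obtain ⟨i, hi⟩ := exists_disjoint_of_encard_lt hslab.disjoint_rows hcard
  obtain ⟨j, hj⟩ := exists_disjoint_of_encard_lt hslab.disjoint_cols hcard
  exact ht (i, j) ⟨hi, hj⟩

end Parity

end Slab

theorem theorem3 {V : Type*} [Finite V] (G : SimpleGraph V) (S₁ S₂ : G.Subgraph) (n Δ : ℕ)
    (hΔ : 3 ≤ Δ) (R C : Fin n → G.Subgraph) (hslab : Slab.IsSlab G S₁ S₂ n R C)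
    (hR : ∀ i, Slab.MaxDegreeAtMost (R i) Δ) (hC : ∀ j, Slab.MaxDegreeAtMost (C j) Δ)
    (X : Set V) (hX₁ : Disjoint X S₁.verts) (hX₂ : Disjoint X S₂.verts)
    (hX : ∀ u ∈ S₁.verts, ∀ v ∈ S₂.verts, ∀ p : G.Walk u v, p.IsPath → ∃ x ∈ p.support, x ∈ X) :
    (n : ℝ) / Real.sqrt (3 * Δ) - 1 ≤ (Slab.treewidth (G.induce X) : ℝ) := by
  have h1 : n ≤ Slab.treewidth (G.induce X) + 1 :=
    hslab.le_of_treewidthAtMost hX₁ hX (Nat.sInf_mem (Slab.exists_treewidthAtMost (G.induce X)))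
  have h2 : (n : ℝ) ≤ Slab.treewidth (G.induce X) + 1 := by exact_mod_cast h1
  have h3 : (1 : ℝ) ≤ Real.sqrt (3 * Δ) := by
    rw [Real.one_le_sqrt]
    have : (3 : ℝ) ≤ Δ := by exact_mod_cast hΔ
    linarith
  have h4 : (n : ℝ) / Real.sqrt (3 * Δ) ≤ n := div_le_self n.cast_nonneg h3
  linarith
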